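/- Let $d$ be a dimension, $N$ a norm on $\mathbb R^d$, and for a bandwidth vector $h\in(0,\infty)^d$ let $d_h(x,y)=N\big((x_1-y_1)/h_1,\dots,(x_d-y_d)/h_d\big)$; for the Euclidean norm this is the weighted Euclidean distance $\big(\sum_j (x_j-y_j)^2/h_j^2\big)^{1/2}$. Let $K:\mathbb R\to[0,\infty)$ be a measurable symmetric kernel. For design points $X_1,\dots,X_n\in\mathbb R^d$ the Nadaraya–Watson smoothing matrix $S$ has entries $S_{ij}=K(d_h(X_i,X_j))/\sum_{l=1}^n K(d_h(X_i,X_l))$ (with $0/0=0$). For a finite positive measure $\mu$ on $\mathbb R^d$ put $\hat\mu(x)=\int e^{-2\pi i\langle t,x\rangle}\,d\mu(t)$. 1. If the inverse Fourier–Stieltjes transform of the kernel is a positive finite measure, i.e. there is a finite positive Borel measure $\mu$ on $\mathbb R^d$ with $K(N(x))=\hat\mu(x)$ for all $x\in\mathbb R^d$, then for every $n$, all bandwidths $h\in(0,\infty)^d$ and all design points, every (complex) eigenvalue of $S$ is real and lies in $[0,1]$. 2. Conversely, suppose that $x\mapsto K(N(x))$ is Lebesgue integrable on $\mathbb R^d$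 (so that, up to normalization, it is a probability density) and that its inverse Fourier–Stieltjes transform is not a positive finite measure, i.e. there is no finite positive Borel measure $\mu$ with $K(N(x))=\hat\mu(x)$ for Lebesgue-almost every $x$. Let $C\subset\mathbb R^d$ be a compact set of positive Lebesgue measure. Then there is $h_0>0$, depending only on $K$, $N$ and $C$, such that for every fixed bandwidth vector $h$ with $0<h_j\le h_0$ for all $j$ and every probability density $f$ on $\mathbb R^d$ that is bounded away from zero on $C$, the following holds: if $X_1,X_2,\dots$ are i.i.d. with density $f$ and $S$ is the smoothing matrix of $X_1,\dots,X_n$, then with probability tending to one as $n\to\infty$, the spectrum of $I-S$ is real and its maximum is larger than $1$. -/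

import Mathlib

open MeasureTheory ProbabilityTheory Filter Topology

noncomputable section

/-- The weighted distance `d_h(x, y) = N ((x_1 - y_1)/h_1, …, (x_d - y_d)/h_d)` on `ℝ^d` with
bandwidth vector `h`. For the Euclidean norm `N` it is `√(∑ j, (x_j - y_j)² / h_j²)`. -/
def weightedDist {d : ℕ} (N : Seminorm ℝ (EuclideanSpace ℝ (Fin d))) (h : Fin d → ℝ)
    (x y : EuclideanSpace ℝ (Fin d)) : ℝ :=
  N (WithLp.toLp 2 fun j => (x j - y j) / h j)

/-- The Nadaraya–Watson smoothing matrix of the design points `x_1, …, x_n`: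
`S_ij = K (d_h(x_i, x_j)) / ∑ l, K (d_h(x_i, x_l))`. -/
def nadarayaWatson {d n : ℕ} (N : Seminorm ℝ (EuclideanSpace ℝ (Fin d))) (h : Fin d → ℝ)
    (K : ℝ → ℝ) (x : Fin n → EuclideanSpace ℝ (Fin d)) : Matrix (Fin n) (Fin n) ℝ :=
  Matrix.of fun i j =>
    K (weightedDist N h (x i) (x j)) / ∑ l, K (weightedDist N h (x i) (x l))

/-- The set of all complex eigenvalues of a real square matrix. -/
def complexSpectrum {n : ℕ} (A : Matrix (Fin n) (Fin n) ℝ) : Set ℂ :=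
  spectrum ℂ (A.map Complex.ofReal)

/-- The Fourier–Stieltjes transform `x ↦ ∫ exp(-2πi⟨t, x⟩) dμ(t)` of a measure on `ℝ^d`. -/
def fourierStieltjes {d : ℕ} (μ : Measure (EuclideanSpace ℝ (Fin d)))
    (x : EuclideanSpace ℝ (Fin d)) : ℂ :=
  ∫ t, Complex.exp (-(2 * Real.pi * Complex.I * (inner ℝ t x : ℝ))) ∂μ

/-- The inverse Fourier–Stieltjes transform of `k` is a positive finite measure: `k` is, at every
point, the Fourier–Stieltjes transform of such a measure. -/
def InverseFSIsPositive {d : ℕ} (k : EuclideanSpace ℝ (Fin d) → ℝ) : Prop :=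
  ∃ μ : Measure (EuclideanSpace ℝ (Fin d)), IsFiniteMeasure μ ∧
    ∀ x, (k x : ℂ) = fourierStieltjes μ x

/-- The same, with equality Lebesgue-almost everywhere only. For continuous `k` this agrees with
`InverseFSIsPositive k`. -/
def InverseFSIsPositiveAE {d : ℕ} (k : EuclideanSpace ℝ (Fin d) → ℝ) : Prop :=
  ∃ μ : Measure (EuclideanSpace ℝ (Fin d)), IsFiniteMeasure μ ∧
    ∀ᵐ x, (k x : ℂ) = fourierStieltjes μ x

/-- The whole spectrum of `A` is real and its maximum is larger than one. -/
def SpectrumMaxGtOne {n : ℕ} (A : Matrix (Fin n) (Fin n) ℝ) : Prop :=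
  ∃ t : ℝ, 1 < t ∧ (t : ℂ) ∈ complexSpectrum A ∧
    ∀ z ∈ complexSpectrum A, ∃ s : ℝ, z = s ∧ s ≤ t

end

/-!
Let `k x = K (N x)`. The smoothing matrix is `D⁻¹ A` with `A = (k (H⁻¹ (X i - X j)))` symmetric with
nonnegative entries, `H` the diagonal matrix of bandwidths and `D` the diagonal matrix of row sums
of `A`. It has the same nonzero eigenvalues as `D^{-1/2} A D^{-1/2}`. Hence its spectrum is real and
at most `1`, and it contains a negative number exactly when `A` is not positive semidefinite
(`exists_real_of_mem_complexSpectrum_rowNormalize`, `spectrumMaxGtOne_one_sub_rowNormalize`).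

If `k` is the Fourier–Stieltjes transform of a positive measure, `A` is positive semidefinite
(`fourierStieltjes_sum_nonneg`).

For the converse, a negative direction of one principal submatrix of `A` suffices, so no law of
large numbers is needed: it is enough that *some* fixed number `m` of sample points is, with
positive probability, in a configuration `y` at which a form `∑ c_i(y_i) c_j(y_j) k(y_i - y_j)`
(`kernelForm`) is negative; then some block of `m` consecutive sample points is in such a
configuration with probability tending to one (`tendsto_measure_exists_block`).

Such forms exist by a version of Bochner's theorem (`exists_measure_of_ae_kernelForm_nonneg`): if
all of them were nonnegative almost everywhere, `k` would be the transform of a positive finite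
measure. The value `k 0` on the diagonal has to be treated separately, since `k` need not be
continuous. It enters twice. The form `2 (k 0 - k (y_0 - y_1))` shows `k ≤ k 0` almost everywhere.
On the other hand, in the mean over `m` independent points the diagonal contributes a multiple of
`m` and the remaining terms a multiple of `m (m - 1)`, so that the double integrals
`∬ g(x) g(y) k(x - y)` against Gaussian laws are nonnegative. Taking cosines and sines for `g` and
flattening the Gaussians gives `𝓕 k ≥ 0`; the bound `k ≤ k 0` gives `∫ 𝓕 k ≤ k 0`; and Fourier
inversion, in the weak sense, identifies `k` with the transform of the measure with density `𝓕 k`.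

Finally, the configurations are moved into `C` by `y ↦ x₀ + H y`. If the bandwidths are small, then
`H y` is small uniformly over a bounded set of configurations, and the intersection of the `m`
translates of `C` by `-H y_i` has positive measure; Fubini's theorem then provides a center `x₀` for
which the moved configurations in `C` have positive measure
(`exists_pos_forall_kernelForm_rescaled_neg`).
-/

/-! ### Row-normalized symmetric matrices -/

section RowNormalize

open Matrix

variable {n : ℕ}

/-- The matrix obtained by dividing each row of `A` by its sum; a row with sum zero becomes zero. -/
noncomputable def rowNormalize (A : Matrix (Fin n) (Fin n) ℝ) : Matrix (Fin n) (Fin n) ℝ :=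
  Matrix.of fun i j => A i j / ∑ l, A i l

lemma mem_complexSpectrum_iff (A : Matrix (Fin n) (Fin n) ℝ) (z : ℂ) :
    z ∈ complexSpectrum A ↔ ∃ v : Fin n → ℂ, v ≠ 0 ∧ A.map Complex.ofReal *ᵥ v = z • v := by
  unfold complexSpectrum
  rw [← Matrix.spectrum_toLin', ← Module.End.hasEigenvalue_iff_mem_spectrum]
  constructor
  · intro h
    obtain ⟨v, hv⟩ := h.exists_hasEigenvector
    exact ⟨v, hv.2, by simpa using hv.apply_eq_smul⟩
  · rintro ⟨v, hv0, hv⟩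
    refine Module.End.hasEigenvalue_of_hasEigenvector (x := v) ⟨?_, hv0⟩
    rw [Module.End.mem_eigenspace_iff]
    simpa using hv

lemma entry_eq_zero_of_rowSum_eq_zero {A : Matrix (Fin n) (Fin n) ℝ} (hA : ∀ i j, 0 ≤ A i j)
    {i : Fin n} (hi : ∑ l, A i l = 0) (j : Fin n) : A i j = 0 :=
  (Finset.sum_eq_zero_iff_of_nonneg fun j _ => hA i j).1 hi j (Finset.mem_univ j)

lemma rowSum_mul_rowNormalize {A : Matrix (Fin n) (Fin n) ℝ} (hA : ∀ i j, 0 ≤ A i j)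
    (i j : Fin n) : (∑ l, A i l) * rowNormalize A i j = A i j := by
  by_cases hi : ∑ l, A i l = 0
  · rw [hi, zero_mul, entry_eq_zero_of_rowSum_eq_zero hA hi]
  · simp only [rowNormalize, Matrix.of_apply]
    field_simp

/-- A real quadratic form applied to a complex vector splits into its values at the real and
imaginary parts. -/
lemma sum_conj_mul_mul_eq {A : Matrix (Fin n) (Fin n) ℝ} (hsymm : ∀ i j, A i j = A j i)
    (v : Fin n → ℂ) :
    ∑ i, ∑ j, (starRingEnd ℂ) (v i) * A i j * v j =
      ((∑ i, ∑ j, A i j * ((v i).re * (v j).re + (v i).im * (v j).im) : ℝ) : ℂ) := by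
  have him : ∑ i, ∑ j, A i j * ((v i).re * (v j).im - (v i).im * (v j).re) = 0 := by
    simp only [mul_sub, Finset.sum_sub_distrib]
    rw [sub_eq_zero, Finset.sum_comm]
    refine Finset.sum_congr rfl fun i _ => Finset.sum_congr rfl fun j _ => ?_
    rw [hsymm j i]; ring
  apply Complex.ext
  · simp only [Complex.re_sum, Complex.ofReal_re]
    refine Finset.sum_congr rfl fun i _ => Finset.sum_congr rfl fun j _ => ?_
    simp; ring
  · rw [Complex.ofReal_im, ← him]
    simp only [Complex.im_sum]
    refine Finset.sum_congr rfl fun i _ => Finset.sum_congr rfl fun j _ => ?_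
    simp; ring

lemma sum_mul_add_mul_le {A : Matrix (Fin n) (Fin n) ℝ} (hA : ∀ i j, 0 ≤ A i j)
    (hsymm : ∀ i j, A i j = A j i) (v : Fin n → ℂ) :
    ∑ i, ∑ j, A i j * ((v i).re * (v j).re + (v i).im * (v j).im) ≤
      ∑ i, (∑ l, A i l) * Complex.normSq (v i) := by
  have h1 : ∑ i, ∑ j, A i j * Complex.normSq (v j) = ∑ i, (∑ l, A i l) * Complex.normSq (v i) := by
    rw [Finset.sum_comm]
    refine Finset.sum_congr rfl fun i _ => ?_
    rw [Finset.sum_mul]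
    exact Finset.sum_congr rfl fun j _ => by rw [hsymm]
  have h2 : ∑ i, ∑ j, A i j * Complex.normSq (v i) =
      ∑ i, (∑ l, A i l) * Complex.normSq (v i) := by
    simp only [Finset.sum_mul]
  have h3 : ∑ i, ∑ j, A i j * ((v i).re * (v j).re + (v i).im * (v j).im) ≤
      ∑ i, ∑ j, (A i j * Complex.normSq (v i) + A i j * Complex.normSq (v j)) / 2 := by
    refine Finset.sum_le_sum fun i _ => Finset.sum_le_sum fun j _ => ?_
    rw [← mul_add, mul_div_assoc]
    refine mul_le_mul_of_nonneg_left ?_ (hA i j)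
    simp only [Complex.normSq_apply]
    nlinarith [sq_nonneg ((v i).re - (v j).re), sq_nonneg ((v i).im - (v j).im)]
  refine h3.trans (le_of_eq ?_)
  simp only [← Finset.sum_div, Finset.sum_add_distrib]
  rw [h1, h2]; ring

/-- An eigenvector `v` of the row normalization with eigenvalue `z ≠ 0` satisfies
`v* A v = z * v* D v` with `D` the diagonal matrix of row sums, and `0 < v* D v`; hence `z` is a
quotient of real numbers. -/
lemma exists_real_of_mem_complexSpectrum_rowNormalize {A : Matrix (Fin n) (Fin n) ℝ}
    (hA : ∀ i j, 0 ≤ A i j) (hsymm : ∀ i j, A i j = A j i) {z : ℂ}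
    (hz : z ∈ complexSpectrum (rowNormalize A)) :
    ∃ s : ℝ, z = s ∧ s ≤ 1 ∧
      ((∀ c : Fin n → ℝ, 0 ≤ ∑ i, ∑ j, c i * c j * A i j) → 0 ≤ s) := by
  obtain ⟨v, hv0, hv⟩ := (mem_complexSpectrum_iff _ _).1 hz
  by_cases hz0 : z = 0
  · exact ⟨0, by simpa using hz0, zero_le_one, fun _ => le_rfl⟩
  have hAv : ∀ i, ∑ j, (A i j : ℂ) * v j = z * ((∑ l, A i l : ℝ) : ℂ) * v i := by
    intro i
    have h := congrFun hv i
    simp only [Matrix.mulVec, dotProduct, Matrix.map_apply, Pi.smul_apply, smul_eq_mul] at h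
    rw [mul_right_comm, ← h, Finset.sum_mul]
    refine Finset.sum_congr rfl fun j _ => ?_
    rw [← rowSum_mul_rowNormalize hA i j]
    push_cast; ring
  set a : ℝ := ∑ i, ∑ j, A i j * ((v i).re * (v j).re + (v i).im * (v j).im) with ha
  set b : ℝ := ∑ i, (∑ l, A i l) * Complex.normSq (v i) with hb
  have hterm : ∀ i ∈ Finset.univ, 0 ≤ (∑ l, A i l) * Complex.normSq (v i) := fun i _ =>
    mul_nonneg (Finset.sum_nonneg fun j _ => hA i j) (Complex.normSq_nonneg _)
  have hab : (a : ℂ) = z * b := by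
    rw [ha, ← sum_conj_mul_mul_eq hsymm, hb]
    push_cast
    rw [Finset.mul_sum]
    refine Finset.sum_congr rfl fun i _ => ?_
    simp only [mul_assoc]
    rw [← Finset.mul_sum, hAv, Complex.normSq_eq_conj_mul_self]
    push_cast; ring
  have hb0 : b ≠ 0 := by
    intro h0
    apply hv0
    funext i
    have hi := (Finset.sum_eq_zero_iff_of_nonneg hterm).1 (hb ▸ h0) i (Finset.mem_univ i)
    rcases mul_eq_zero.1 hi with hD | hn
    · have h := congrFun hv i
      simp only [Matrix.mulVec, dotProduct, Matrix.map_apply, Pi.smul_apply, smul_eq_mul,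
        rowNormalize, Matrix.of_apply, hD, div_zero, Complex.ofReal_zero, zero_mul,
        Finset.sum_const_zero] at h
      exact (mul_eq_zero.1 h.symm).resolve_left hz0
    · exact Complex.normSq_eq_zero.1 hn
  have hbpos : 0 < b := lt_of_le_of_ne (Finset.sum_nonneg hterm) hb0.symm
  refine ⟨a / b, ?_, ?_, fun hpsd => ?_⟩
  · have : (b : ℂ) ≠ 0 := by exact_mod_cast hb0
    push_cast
    rw [hab]; field_simp
  · exact (div_le_one hbpos).2 (sum_mul_add_mul_le hA hsymm v)
  · refine div_nonneg ?_ hbpos.le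
    have h1 := add_nonneg (hpsd fun i => (v i).re) (hpsd fun i => (v i).im)
    rw [ha]
    refine h1.trans (le_of_eq ?_)
    simp only [← Finset.sum_add_distrib]
    refine Finset.sum_congr rfl fun i _ => Finset.sum_congr rfl fun j _ => ?_
    ring

/-- `D⁻¹ A` has the same nonzero eigenvalues as the symmetric matrix `D^{-1/2} A D^{-1/2}`, which
fails to be positive semidefinite together with `A`. -/
lemma exists_neg_mem_complexSpectrum_rowNormalize {A : Matrix (Fin n) (Fin n) ℝ}
    (hA : ∀ i j, 0 ≤ A i j) (hsymm : ∀ i j, A i j = A j i) {c : Fin n → ℝ}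
    (hc : ∑ i, ∑ j, c i * c j * A i j < 0) :
    ∃ t : ℝ, t < 0 ∧ (t : ℂ) ∈ complexSpectrum (rowNormalize A) := by
  set D : Fin n → ℝ := fun i => ∑ l, A i l with hD
  have hD0 : ∀ i, 0 ≤ D i := fun i => Finset.sum_nonneg fun j _ => hA i j
  -- If a row sum vanishes, so does its inverse square root, by the convention `0⁻¹ = 0`.
  set r : Fin n → ℝ := fun i => (√(D i))⁻¹ with hr
  have hrA : ∀ i j, √(D i) * r i * A i j = A i j := by
    intro i j
    by_cases hi : D i = 0
    · rw [entry_eq_zero_of_rowSum_eq_zero hA hi j, mul_zero]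
    · have : √(D i) ≠ 0 := by
        rw [Real.sqrt_ne_zero (hD0 i)]; exact hi
      rw [hr]; field_simp
  set B : Matrix (Fin n) (Fin n) ℝ := Matrix.of fun i j => r i * A i j * r j with hB
  have hBherm : B.IsHermitian := by
    ext i j
    simp only [hB, Matrix.conjTranspose_apply, Matrix.of_apply, star_trivial]
    rw [hsymm j i]; ring
  have hnot : ¬ B.PosSemidef := by
    intro hpsd
    have h := hpsd.dotProduct_mulVec_nonneg fun i => √(D i) * c i
    refine absurd hc (not_lt.2 (h.trans (le_of_eq ?_)))
    simp only [dotProduct, Matrix.mulVec, Pi.star_apply, star_trivial, hB, Matrix.of_apply,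
      Finset.mul_sum]
    refine Finset.sum_congr rfl fun i _ => Finset.sum_congr rfl fun j _ => ?_
    have h1 : A i j = √(D i) * r i * (√(D j) * r j * A i j) := by
      rw [hsymm i j, hrA j i, ← hsymm i j, hrA i j]
    conv_rhs => rw [h1]
    ring
  rw [hBherm.posSemidef_iff_eigenvalues_nonneg, Pi.le_def, not_forall] at hnot
  obtain ⟨p, hp⟩ := hnot
  have hp' : hBherm.eigenvalues p < 0 := not_le.1 hp
  set t := hBherm.eigenvalues p
  -- If `B x = t x` with `B = D^{-1/2} A D^{-1/2}`, then `D^{-1/2} x` is an eigenvector of `D⁻¹ A`.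
  set x : Fin n → ℝ := ⇑(hBherm.eigenvectorBasis p) with hx
  have hBx : ∀ i, r i * ∑ j, A i j * (r j * x j) = t * x i := by
    intro i
    have h := congrFun (hBherm.mulVec_eigenvectorBasis p) i
    simp only [Matrix.mulVec, dotProduct, hB, Matrix.of_apply, Pi.smul_apply, smul_eq_mul] at h
    rw [← h, Finset.mul_sum]
    exact Finset.sum_congr rfl fun j _ => by rw [hx]; ring
  have hx0 : x ≠ 0 := by
    intro h0
    apply hBherm.eigenvectorBasis.toBasis.ne_zero p
    ext i
    simpa using congrFun h0 i
  refine ⟨t, hp', (mem_complexSpectrum_iff _ _).2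
    ⟨fun i => ((r i * x i : ℝ) : ℂ), fun h0 => hx0 (funext fun i => ?_), funext fun i => ?_⟩⟩
  · have hrx : ∀ j, r j * x j = 0 := fun j => Complex.ofReal_eq_zero.1 (congrFun h0 j)
    have h := hBx i
    simp only [hrx, mul_zero, Finset.sum_const_zero] at h
    exact (mul_eq_zero.1 h.symm).resolve_left hp'.ne
  · simp only [Matrix.mulVec, dotProduct, Matrix.map_apply, Pi.smul_apply, smul_eq_mul]
    have hri : ∀ j, rowNormalize A i j = r i * (r i * A i j) := by
      intro j
      have hrr : r i * r i = (D i)⁻¹ := by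
        rw [hr, ← mul_inv, Real.mul_self_sqrt (hD0 i)]
      rw [← mul_assoc, hrr]
      simp only [rowNormalize, Matrix.of_apply]
      rw [div_eq_inv_mul]
    have : ∑ j, rowNormalize A i j * (r j * x j) = t * (r i * x i) := by
      rw [mul_left_comm, ← hBx i, Finset.mul_sum, Finset.mul_sum]
      exact Finset.sum_congr rfl fun j _ => by rw [hri]; ring
    exact_mod_cast this

lemma spectrumMaxGtOne_one_sub_rowNormalize {A : Matrix (Fin n) (Fin n) ℝ}
    (hA : ∀ i j, 0 ≤ A i j) (hsymm : ∀ i j, A i j = A j i) {c : Fin n → ℝ}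
    (hc : ∑ i, ∑ j, c i * c j * A i j < 0) :
    SpectrumMaxGtOne (1 - rowNormalize A) := by
  have hmem : ∀ z : ℂ, z ∈ complexSpectrum (1 - rowNormalize A) ↔
      1 - z ∈ complexSpectrum (rowNormalize A) := by
    intro z
    rw [mem_complexSpectrum_iff, mem_complexSpectrum_iff]
    refine exists_congr fun v => and_congr_right fun _ => ?_
    have : ((1 : Matrix (Fin n) (Fin n) ℝ) - rowNormalize A).map Complex.ofReal =
        1 - (rowNormalize A).map Complex.ofReal := by
      ext i j
      by_cases hij : i = j <;> simp [hij]
    rw [this, Matrix.sub_mulVec, Matrix.one_mulVec, sub_smul, one_smul]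
    constructor <;> intro h
    · rw [← h]; abel
    · rw [h]; abel
  have hfin : (complexSpectrum (1 - rowNormalize A)).Finite := Matrix.finite_spectrum _
  obtain ⟨t, ht, htS⟩ := exists_neg_mem_complexSpectrum_rowNormalize hA hsymm hc
  have hmem_t : ((1 - t : ℝ) : ℂ) ∈ complexSpectrum (1 - rowNormalize A) := by
    rw [hmem]; simpa using htS
  obtain ⟨m, hm, hmax⟩ := Set.exists_max_image _ Complex.re hfin ⟨_, hmem_t⟩
  have hreal : ∀ z ∈ complexSpectrum (1 - rowNormalize A), z = (z.re : ℂ) := by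
    intro z hz
    obtain ⟨s, hs, -⟩ :=
      exists_real_of_mem_complexSpectrum_rowNormalize hA hsymm ((hmem z).1 hz)
    have : z = ((1 - s : ℝ) : ℂ) := by
      push_cast; rw [← hs]; ring
    rw [this, Complex.ofReal_re]
  refine ⟨m.re, ?_, hreal m hm ▸ hm, fun z hz => ⟨z.re, hreal z hz, hmax z hz⟩⟩
  have := hmax _ hmem_t
  rw [Complex.ofReal_re] at this
  linarith

end RowNormalize

/-! ### Positive definiteness of Fourier–Stieltjes transforms -/

lemma fourierStieltjes_sum_nonneg {d n : ℕ} {k : EuclideanSpace ℝ (Fin d) → ℝ}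
    (hk : InverseFSIsPositive k) (c : Fin n → ℝ) (y : Fin n → EuclideanSpace ℝ (Fin d)) :
    0 ≤ ∑ i, ∑ j, c i * c j * k (y i - y j) := by
  obtain ⟨μ, hμ, hk⟩ := hk
  set e : EuclideanSpace ℝ (Fin d) → EuclideanSpace ℝ (Fin d) → ℂ := fun x t =>
    Complex.exp (-(2 * Real.pi * Complex.I * (inner ℝ t x : ℝ))) with he
  have hint : ∀ x, Integrable (e x) μ := by
    intro x
    refine Integrable.of_bound (C := 1) ?_ (ae_of_all _ fun t => ?_)
    · exact (by fun_prop : Continuous (e x)).aestronglyMeasurable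
    · rw [he, Complex.norm_exp]
      simp
  have hsq : ∀ t, ∑ i, ∑ j, ((c i * c j : ℝ) : ℂ) * e (y i - y j) t =
      ((Complex.normSq (∑ i, c i * e (y i) t) : ℝ) : ℂ) := by
    intro t
    rw [← Complex.mul_conj, map_sum, Finset.sum_mul_sum]
    refine Finset.sum_congr rfl fun i _ => Finset.sum_congr rfl fun j _ => ?_
    have h1 : (starRingEnd ℂ) (e (y j) t) =
        Complex.exp (2 * Real.pi * Complex.I * (inner ℝ t (y j) : ℝ)) := by
      simp [he, ← Complex.exp_conj, map_ofNat]
    rw [map_mul, h1, Complex.conj_ofReal, Complex.ofReal_mul, mul_mul_mul_comm]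
    simp only [he]
    rw [← Complex.exp_add, inner_sub_right]
    congr 2
    push_cast; ring
  have key : ((∑ i, ∑ j, c i * c j * k (y i - y j) : ℝ) : ℂ) =
      ((∫ t, Complex.normSq (∑ i, c i * e (y i) t) ∂μ : ℝ) : ℂ) := by
    rw [← integral_complex_ofReal]
    simp only [← hsq]
    rw [integral_finsetSum _ fun i _ => integrable_finsetSum _ fun j _ => (hint _).const_mul _]
    push_cast
    refine Finset.sum_congr rfl fun i _ => ?_
    rw [integral_finsetSum _ fun j _ => (hint _).const_mul _]
    refine Finset.sum_congr rfl fun j _ => ?_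
    rw [integral_const_mul, hk]
    rfl
  rw [Complex.ofReal_inj.1 key]
  exact integral_nonneg fun t => Complex.normSq_nonneg _

/-! ### Blocks of an independent sequence -/

lemma absolutelyContinuous_pi {α : Type*} [MeasurableSpace α] {μ ν : Measure α} [SigmaFinite μ]
    [SigmaFinite ν] (h : μ ≪ ν) (m : ℕ) :
    Measure.pi (fun _ : Fin m => μ) ≪ Measure.pi (fun _ : Fin m => ν) := by
  induction m with
  | zero =>
    rw [Measure.pi_of_empty, Measure.pi_of_empty]
  | succ m ih =>
    have h1 := (measurePreserving_piFinSuccAbove (fun _ : Fin (m + 1) => μ) 0).symm.map_eq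
    have h2 := (measurePreserving_piFinSuccAbove (fun _ : Fin (m + 1) => ν) 0).symm.map_eq
    rw [← h1, ← h2]
    exact (h.prod ih).map (MeasurableEquiv.measurable _)

/-- Disjoint blocks of an independent family are independent. -/
lemma iIndepFun_blocks {Ω α ι κ : Type*} [MeasurableSpace Ω] [MeasurableSpace α] {P : Measure Ω}
    [IsProbabilityMeasure P] {X : ι → κ → Ω → α} (hX : ∀ i j, Measurable (X i j))
    (h : iIndepFun (fun (p : ι × κ) => X p.1 p.2) P) :
    iIndepFun (fun i ω j => X i j ω) P := by
  have hprob : ∀ i j, IsProbabilityMeasure (P.map (X i j)) := fun i j =>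
    Measure.isProbabilityMeasure_map (hX i j).aemeasurable
  have hσ : iIndepFun (fun (p : (_ : ι) × κ) => X p.1 p.2) P :=
    h.precomp (Equiv.sigmaEquivProd ι κ).injective
  have hrow : ∀ i, iIndepFun (X i) P := fun i =>
    h.precomp (g := fun j => (i, j)) (Prod.mk_right_injective i)
  rw [iIndepFun_iff_map_fun_eq_infinitePi_map (by fun_prop)]
  have hcomp : (MeasurableEquiv.piCurry fun (_ : ι) (_ : κ) => α) ∘
      (fun ω (p : (_ : ι) × κ) => X p.1 p.2 ω) = fun ω i j => X i j ω := by
    ext; simp [Sigma.curry]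
  rw [← hcomp, ← Measure.map_map (by fun_prop) (by fun_prop),
    (iIndepFun_iff_map_fun_eq_infinitePi_map (by fun_prop)).1 hσ,
    Measure.infinitePi_map_piCurry (fun i j => P.map (X i j))]
  congr 1
  ext1 i
  rw [(iIndepFun_iff_map_fun_eq_infinitePi_map (by fun_prop)).1 (hrow i)]

/-- If a configuration of `m` independent points lies in `G` with positive probability, then some
block of `m` consecutive points among the first `n` lies in `G` with probability tending to one. -/
lemma tendsto_measure_exists_block {Ω α : Type*} [MeasurableSpace Ω] [MeasurableSpace α]
    {P : Measure Ω} [IsProbabilityMeasure P] {X : ℕ → Ω → α} (hX : ∀ i, Measurable (X i))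
    (hindep : iIndepFun X P) {ν : Measure α} (hν : ∀ i, P.map (X i) = ν) {m : ℕ}
    {G : Set (Fin m → α)} (hG : MeasurableSet G) (hpos : Measure.pi (fun _ : Fin m => ν) G ≠ 0) :
    Tendsto (fun n : ℕ => P {ω | ∃ j, (j + 1) * m ≤ n ∧ (fun i : Fin m => X (j * m + i) ω) ∈ G})
      atTop (𝓝 1) := by
  have hinj : Function.Injective fun p : ℕ × Fin m => p.1 * m + p.2 := by
    rintro ⟨a, i⟩ ⟨b, j⟩ hab
    have hm : 0 < m := i.pos
    simp only at hab
    have h1 : a = b := by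
      have := congrArg (· / m) hab
      simpa [Nat.mul_add_div, mul_comm _ m, Nat.div_eq_of_lt i.2, Nat.div_eq_of_lt j.2,
        hm.ne', hm] using this
    subst h1
    exact Prod.ext rfl (Fin.ext (by simpa using hab))
  have hind2 : iIndepFun (fun (p : ℕ × Fin m) => X (p.1 * m + p.2)) P := hindep.precomp hinj
  have hblocks : iIndepFun (fun (j : ℕ) ω (i : Fin m) => X (j * m + i) ω) P :=
    iIndepFun_blocks (X := fun (j : ℕ) (i : Fin m) => X (j * m + i)) (fun _ _ => hX _) hind2
  have hZmeas : ∀ j : ℕ, Measurable fun ω (i : Fin m) => X (j * m + i) ω := fun j =>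
    measurable_pi_lambda _ fun i => hX _
  set B : ℕ → Set Ω := fun j => (fun ω (i : Fin m) => X (j * m + i) ω) ⁻¹' G with hB
  have hBmeas : ∀ j, MeasurableSet (B j) := fun j => hZmeas j hG
  have hBind : iIndepSet B P := by
    rw [iIndepSet_iff_meas_biInter hBmeas]
    intro s
    exact hblocks.meas_biInter fun j _ => ⟨G, hG, rfl⟩
  have hBprob : ∀ j, P (B j) = Measure.pi (fun _ : Fin m => ν) G := by
    intro j
    have hrow : iIndepFun (fun i : Fin m => X (j * m + i)) P :=
      hind2.precomp (g := fun i => (j, i)) (Prod.mk_right_injective j)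
    rw [hB, ← Measure.map_apply (hZmeas j) hG,
      (iIndepFun_iff_map_fun_eq_pi_map fun i => (hX _).aemeasurable).1 hrow]
    simp only [hν]
  -- Second Borel–Cantelli lemma: almost surely some block lies in `G`.
  have hlim : P (limsup B atTop) = 1 := by
    refine measure_limsup_eq_one hBmeas hBind ?_
    simp only [hBprob]
    exact ENNReal.tsum_const_eq_top_of_ne_zero hpos
  have hunion : P (⋃ n : ℕ, {ω | ∃ j, (j + 1) * m ≤ n ∧
      (fun i : Fin m => X (j * m + i) ω) ∈ G}) = 1 := by
    refine le_antisymm prob_le_one (hlim ▸ measure_mono fun ω hω => ?_)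
    obtain ⟨j, -, hj⟩ := (frequently_atTop.1 (mem_limsup_iff_frequently_mem.1 hω)) 0
    exact Set.mem_iUnion.2 ⟨(j + 1) * m, j, le_rfl, hj⟩
  rw [← hunion]
  refine tendsto_measure_iUnion_atTop fun a b hab ω => ?_
  rintro ⟨j, hj, hjG⟩
  exact ⟨j, hj.trans hab, hjG⟩

/-! ### Random quadratic forms and their transport into a compact set -/

/-- The quadratic form of the matrix `(k (y i - y j))` evaluated at the coefficient vector
`(c i (y i))`, whose entries may depend on the points. -/
noncomputable def kernelForm {V : Type*} [Sub V] (k : V → ℝ) {m : ℕ} (c : Fin m → V → ℝ)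
    (y : Fin m → V) : ℝ :=
  ∑ i, ∑ j, c i (y i) * c j (y j) * k (y i - y j)

section Transport

variable {V : Type*} [NormedAddCommGroup V] [InnerProductSpace ℝ V] [FiniteDimensional ℝ V]
  [MeasurableSpace V] [BorelSpace V]

lemma measurable_kernelForm {k : V → ℝ} (hk : Measurable k) {m : ℕ} {c : Fin m → V → ℝ}
    (hc : ∀ i, Measurable (c i)) : Measurable (kernelForm k c) := by
  unfold kernelForm
  fun_prop

/-- A compact set of positive measure has a common point with its translates by finitely many small
vectors; moreover such points have positive measure. -/
lemma exists_pos_forall_translates_inter {C : Set V} (hC : IsCompact C) (hpos : 0 < volume C)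
    (m : ℕ) : ∃ δ : ℝ, 0 < δ ∧ ∀ z : Fin m → V, (∀ i, ‖z i‖ ≤ δ) →
      volume {x | ∀ i, x + z i ∈ C} ≠ 0 := by
  have hfin : volume C ≠ ⊤ := hC.measure_lt_top.ne
  -- Each translate misses at most `ε` of `C`, and `m * ε < volume C`.
  set ε := volume C / (m + 1) with hε
  have hε0 : ε ≠ 0 := by
    rw [hε]
    refine (ENNReal.div_pos hpos.ne' ?_).ne'
    exact_mod_cast ENNReal.natCast_ne_top (m + 1)
  have hlim := tendsto_measure_cthickening_of_isCompact (μ := volume) hC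
  have hlt : volume C < volume C + ε := ENNReal.lt_add_right hfin hε0
  obtain ⟨δ, hδ, hδpos⟩ := (((hlim.eventually_lt_const hlt).filter_mono
    (nhdsWithin_le_nhds (s := Set.Ioi (0 : ℝ)))).and self_mem_nhdsWithin).exists
  refine ⟨δ, hδpos, fun z hz h0 => ?_⟩
  have hdiff : ∀ i, volume (C \ {x | x + z i ∈ C}) ≤ ε := by
    intro i
    have hmeas : MeasurableSet {x | x + z i ∈ C} := (measurable_add_const (z i)) hC.measurableSet
    have hvol : volume {x | x + z i ∈ C} = volume C := measure_preimage_add_right volume (z i) C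
    have hsub : {x | x + z i ∈ C} ⊆ Metric.cthickening δ C := by
      intro x hx
      refine Metric.mem_cthickening_of_dist_le x (x + z i) δ C hx ?_
      simpa [dist_eq_norm] using hz i
    calc volume (C \ {x | x + z i ∈ C})
        ≤ volume (Metric.cthickening δ C \ {x | x + z i ∈ C}) :=
          measure_mono (Set.sdiff_subset_sdiff_left (Metric.self_subset_cthickening C))
      _ = volume (Metric.cthickening δ C) - volume C := by
          rw [measure_sdiff hsub hmeas.nullMeasurableSet (hvol ▸ hfin), hvol]
      _ ≤ ε := tsub_le_iff_left.2 hδ.le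
  have hcover : C ⊆ {x | ∀ i, x + z i ∈ C} ∪ ⋃ i, C \ {x | x + z i ∈ C} := by
    intro x hx
    by_cases h : ∀ i, x + z i ∈ C
    · exact Or.inl h
    · obtain ⟨i, hi⟩ := not_forall.1 h
      exact Or.inr (Set.mem_iUnion.2 ⟨i, hx, hi⟩)
  have hle : volume C ≤ m * ε := by
    calc volume C ≤ volume {x | ∀ i, x + z i ∈ C} + volume (⋃ i, C \ {x | x + z i ∈ C}) :=
          (measure_mono hcover).trans (measure_union_le _ _)
      _ ≤ 0 + ∑ i : Fin m, ε := by
          rw [h0]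
          gcongr
          exact (measure_iUnion_fintype_le _ _).trans (Finset.sum_le_sum fun i _ => hdiff i)
      _ = m * ε := by simp
  have hsum : (m + 1) * ε = volume C := by
    rw [hε]
    refine ENNReal.mul_div_cancel (by simp) ?_
    exact_mod_cast ENNReal.natCast_ne_top (m + 1)
  have hεfin : ε ≠ ⊤ := fun h => hfin (by rw [← hsum, h]; simp)
  have : m * ε + ε ≤ m * ε + 0 := by
    rw [add_zero, ← add_one_mul, hsum]; exact hle
  exact hε0 (le_zero_iff.1
    ((ENNReal.add_le_add_iff_left (ENNReal.mul_ne_top (ENNReal.natCast_ne_top m) hεfin)).1 this))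

/-- If the form is negative with positive probability for points drawn from an absolutely continuous
law, then for every sufficiently contracting linear change of variables `T` it is negative, after
rescaling by `T` and recentering, with positive probability for points drawn from any law that
dominates Lebesgue measure on `C`. -/
lemma exists_pos_forall_kernelForm_rescaled_neg {k : V → ℝ} (hk : Measurable k) {ν : Measure V}
    [IsProbabilityMeasure ν] (hν : ν ≪ volume) {m : ℕ} {c : Fin m → V → ℝ}
    (hc : ∀ i, Measurable (c i))
    (hneg : Measure.pi (fun _ : Fin m => ν) {y | kernelForm k c y < 0} ≠ 0)
    {C : Set V} (hC : IsCompact C) (hpos : 0 < volume C) :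
    ∃ h₀ : ℝ, 0 < h₀ ∧ ∀ T : V ≃L[ℝ] V, (∀ y, ‖T y‖ ≤ h₀ * ‖y‖) →
      ∀ (ρ : Measure V) [SigmaFinite ρ], volume.restrict C ≪ ρ →
        ∃ x₀ : V, Measure.pi (fun _ : Fin m => ρ)
          {x | kernelForm (fun z => k (T.symm z)) (fun i x => c i (T.symm (x - x₀))) x < 0} ≠ 0 := by
  set E : Set (Fin m → V) := {y | kernelForm k c y < 0} with hE
  have hEmeas : MeasurableSet E := measurable_kernelForm hk hc measurableSet_Iio
  obtain ⟨R, hR⟩ : ∃ R : ℕ, Measure.pi (fun _ : Fin m => ν) (E ∩ {y | ∀ i, ‖y i‖ ≤ R}) ≠ 0 := by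
    by_contra! hall
    apply hneg
    refine measure_mono_null (fun y hy => ?_) (measure_iUnion_null hall)
    obtain ⟨R, hR⟩ := exists_nat_ge (∑ i, ‖y i‖)
    refine Set.mem_iUnion.2 ⟨R, hy, fun i => le_trans ?_ hR⟩
    exact Finset.single_le_sum (fun i _ => norm_nonneg (y i)) (Finset.mem_univ i)
  set F : Set (Fin m → V) := E ∩ {y | ∀ i, ‖y i‖ ≤ R} with hF
  have hFmeas : MeasurableSet F := by
    refine hEmeas.inter ?_
    rw [Set.ofPred_forall]
    exact MeasurableSet.iInter fun i =>
      measurableSet_le (measurable_pi_apply i).norm measurable_const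
  obtain ⟨δ, hδ, htrans⟩ := exists_pos_forall_translates_inter hC hpos m
  have hR1 : (0 : ℝ) < R + 1 := by positivity
  refine ⟨δ / (R + 1), by positivity, fun T hT ρ _ hρ => ?_⟩
  -- By Fubini's theorem, as otherwise for almost every `y ∈ F` the centers `x₀` that move `y` into
  -- `C` would form a null set.
  obtain ⟨x₀, hx₀⟩ : ∃ x₀ : V, Measure.pi (fun _ : Fin m => ν)
      {y | y ∈ F ∧ ∀ i, x₀ + T (y i) ∈ C} ≠ 0 := by
    by_contra! hall
    apply hR
    have hmeasC : MeasurableSet {p : V × (Fin m → V) | ∀ i, p.1 + T (p.2 i) ∈ C} := by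
      rw [Set.ofPred_forall]
      refine MeasurableSet.iInter fun i => ?_
      have : Measurable fun p : V × (Fin m → V) => p.1 + T (p.2 i) :=
        measurable_fst.add
          (T.continuous.measurable.comp ((measurable_pi_apply i).comp measurable_snd))
      exact this hC.measurableSet
    have hmeas : MeasurableSet {p : V × (Fin m → V) | ¬ (p.2 ∈ F ∧ ∀ i, p.1 + T (p.2 i) ∈ C)} :=
      ((measurable_snd hFmeas).inter hmeasC).compl
    have h1 : ∀ᵐ x ∂(volume : Measure V), ∀ᵐ y ∂(Measure.pi fun _ : Fin m => ν),
        ¬ (y ∈ F ∧ ∀ i, x + T (y i) ∈ C) := by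
      refine ae_of_all _ fun x => ?_
      rw [ae_iff]
      simpa using hall x
    have h2 := (Measure.ae_ae_comm hmeas).1 h1
    rw [measure_eq_zero_iff_ae_notMem]
    filter_upwards [h2] with y hy hyF
    refine htrans (fun i => T (y i)) (fun i => ?_) ?_
    · calc ‖T (y i)‖ ≤ δ / (R + 1) * ‖y i‖ := hT _
        _ ≤ δ / (R + 1) * (R + 1) := by
            have := hyF.2 i
            gcongr; linarith
        _ = δ := by field_simp
    · rw [measure_eq_zero_iff_ae_notMem]
      filter_upwards [hy] with x hx hxC
      exact hx ⟨hyF, hxC⟩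
  refine ⟨x₀, fun h0 => hx₀ ?_⟩
  set G : Set (Fin m → V) :=
    {x | kernelForm (fun z => k (T.symm z)) (fun i x => c i (T.symm (x - x₀))) x < 0} with hG
  have hGmeas : MeasurableSet G := by
    refine measurable_kernelForm (hk.comp T.symm.continuous.measurable) (fun i => ?_)
      measurableSet_Iio
    exact (hc i).comp (T.symm.continuous.measurable.comp (measurable_id.sub_const x₀))
  have hτ : Measurable fun y => x₀ + T y := T.continuous.measurable.const_add x₀
  have hrestr : Measure.pi (fun _ : Fin m => (volume : Measure V))
      (G ∩ Set.univ.pi fun _ => C) = 0 := by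
    rw [← Measure.restrict_apply hGmeas, Measure.restrict_pi_pi]
    exact absolutelyContinuous_pi hρ m h0
  have hmap : ν.map (fun y => x₀ + T y) ≪ volume := by
    have h1 : ν.map T ≪ volume := by
      have : (volume.map T).IsAddHaarMeasure := T.isAddHaarMeasure_map volume
      exact (hν.map T.continuous.measurable).trans
        (Measure.absolutelyContinuous_isAddHaarMeasure _ _)
    have h2 : ν.map (fun y => x₀ + T y) = (ν.map T).map (fun y => x₀ + y) := by
      rw [Measure.map_map (measurable_const_add x₀) T.continuous.measurable]
      rfl
    rw [h2, ← (measurePreserving_add_left (volume : Measure V) x₀).map_eq]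
    exact h1.map (measurable_const_add x₀)
  have hprob : IsProbabilityMeasure (ν.map fun y => x₀ + T y) :=
    Measure.isProbabilityMeasure_map hτ.aemeasurable
  have h3 := absolutelyContinuous_pi hmap m hrestr
  have hτpi : Measurable fun (y : Fin m → V) i => x₀ + T (y i) :=
    measurable_pi_lambda _ fun i => hτ.comp (measurable_pi_apply i)
  rw [← Measure.pi_map_pi (fun _ => hτ.aemeasurable), Measure.map_apply hτpi
    (hGmeas.inter (MeasurableSet.univ_pi fun _ => hC.measurableSet))] at h3
  refine measure_mono_null ?_ h3
  rintro y ⟨hyF, hyC⟩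
  refine ⟨?_, fun i _ => hyC i⟩
  have hy : kernelForm k c y < 0 := hyF.1
  simpa [hG, kernelForm, ← map_sub] using hy

end Transport

/-! ### Almost surely positive definite functions -/

/-- The mean of the form over `m` independent points with a common coefficient function `g` is
`m k(0) ∫ g² + m (m - 1) ∬ g(x) g(y) k(x - y)`, so the double integral cannot be negative: it
dominates as `m → ∞`, whatever the value `k(0)`. -/
lemma integral_prod_nonneg_of_kernelForm_nonneg {V : Type*} [AddGroup V]
    [MeasurableSpace V] {k : V → ℝ} {ν : Measure V}
    [IsProbabilityMeasure ν] (hint : Integrable (fun p : V × V => k (p.1 - p.2)) (ν.prod ν))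
    {g : V → ℝ} (hg : Measurable g) (hg1 : ∀ x, ‖g x‖ ≤ 1)
    (h : ∀ m : ℕ, ∀ᵐ y ∂Measure.pi fun _ : Fin m => ν, 0 ≤ kernelForm k (fun _ => g) y) :
    0 ≤ ∫ p : V × V, g p.1 * g p.2 * k (p.1 - p.2) ∂ν.prod ν := by
  set J := ∫ p : V × V, g p.1 * g p.2 * k (p.1 - p.2) ∂ν.prod ν with hJ
  set I := k 0 * ∫ x, g x * g x ∂ν with hI
  have hJint : Integrable (fun p : V × V => g p.1 * g p.2 * k (p.1 - p.2)) (ν.prod ν) := by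
    refine hint.bdd_mul (c := 1)
      ((hg.comp measurable_fst).mul (hg.comp measurable_snd)).aestronglyMeasurable
      (ae_of_all _ fun p => ?_)
    rw [norm_mul]
    exact mul_le_one₀ (hg1 _) (norm_nonneg _) (hg1 _)
  have hIint : Integrable (fun x => g x * g x * k 0) ν := by
    refine (Integrable.of_bound (C := 1) (hg.mul hg).aestronglyMeasurable
      (ae_of_all _ fun x => ?_)).mul_const _
    rw [Pi.mul_apply, norm_mul]
    exact mul_le_one₀ (hg1 _) (norm_nonneg _) (hg1 _)
  have hpair : ∀ {m : ℕ} {i j : Fin m}, i ≠ j →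
      MeasurePreserving (fun y : Fin m → V => (y i, y j)) (Measure.pi fun _ => ν) (ν.prod ν) := by
    intro m i j hij
    have hind : iIndepFun (fun (i : Fin m) (y : Fin m → V) => y i) (Measure.pi fun _ => ν) :=
      iIndepFun_pi (μ := fun _ : Fin m => ν) (X := fun _ => id) fun _ => aemeasurable_id
    have hmeas : ∀ l : Fin m, Measurable fun y : Fin m → V => y l := fun l => measurable_pi_apply l
    refine ⟨(hmeas i).prodMk (hmeas j), ?_⟩
    rw [(indepFun_iff_map_prod_eq_prod_map_map (hmeas i).aemeasurable (hmeas j).aemeasurable).1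
      (hind.indepFun hij)]
    congr 1
    · exact (measurePreserving_eval (fun _ : Fin m => ν) i).map_eq
    · exact (measurePreserving_eval (fun _ : Fin m => ν) j).map_eq
  have hterm : ∀ {m : ℕ} (i j : Fin m),
      Integrable (fun y : Fin m → V => g (y i) * g (y j) * k (y i - y j)) (Measure.pi fun _ => ν) ∧
      ∫ y : Fin m → V, g (y i) * g (y j) * k (y i - y j) ∂(Measure.pi fun _ => ν) =
        if i = j then I else J := by
    intro m i j
    by_cases hij : i = j
    · subst hij
      have hmp := measurePreserving_eval (fun _ : Fin m => ν) i
      simp only [sub_self, if_true]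
      refine ⟨hmp.integrable_comp_of_integrable hIint, ?_⟩
      have hmap := integral_map hmp.measurable.aemeasurable
        (hmp.map_eq.symm ▸ hIint.aestronglyMeasurable)
      rw [hmp.map_eq] at hmap
      rw [hI, mul_comm, ← integral_mul_const, hmap]
    · rw [if_neg hij]
      have hmp := hpair hij
      refine ⟨hmp.integrable_comp_of_integrable hJint, ?_⟩
      have hmap := integral_map hmp.measurable.aemeasurable
        (hmp.map_eq.symm ▸ hJint.aestronglyMeasurable)
      rw [hmp.map_eq] at hmap
      rw [hJ, hmap]
  have hmean : ∀ m : ℕ, 0 ≤ I + m * J := by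
    intro m
    have h0 := integral_nonneg_of_ae (h (m + 1))
    unfold kernelForm at h0
    rw [integral_finsetSum _ fun i _ => integrable_finsetSum _ fun j _ => (hterm i j).1] at h0
    simp_rw [integral_finsetSum _ fun j _ => (hterm _ j).1, (hterm _ _).2] at h0
    have hsum : ∀ i : Fin (m + 1), ∑ j, (if i = j then I else J) = I + m * J := by
      intro i
      rw [← Finset.add_sum_erase _ _ (Finset.mem_univ i), if_pos rfl,
        Finset.sum_congr rfl fun j hj => if_neg (Finset.ne_of_mem_erase hj).symm]
      simp
    simp only [hsum, Finset.sum_const, Finset.card_univ, Fintype.card_fin, nsmul_eq_mul] at h0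
    exact nonneg_of_mul_nonneg_right h0 (by positivity)
  by_contra! hneg
  obtain ⟨m, hm⟩ := exists_nat_gt (I / -J)
  have := hmean m
  rw [div_lt_iff₀ (neg_pos.2 hneg)] at hm
  linarith

section PositiveDefinite

variable {V : Type*} [NormedAddCommGroup V] [InnerProductSpace ℝ V] [FiniteDimensional ℝ V]
  [MeasurableSpace V] [BorelSpace V]

/-- The forms with coefficients `1` and `-1` at two points bound `k` by its value at the origin. -/
lemma ae_le_apply_zero {k : V → ℝ} (hk : Measurable k) (heven : ∀ x, k (-x) = k x)
    (h : ∀ᵐ y ∂Measure.pi fun _ : Fin 2 => (volume : Measure V),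
      0 ≤ kernelForm k (fun i _ => ![(1 : ℝ), -1] i) y) :
    ∀ᵐ z, k z ≤ k 0 := by
  have h1 : ∀ᵐ y : Fin 2 → V ∂Measure.pi fun _ => (volume : Measure V),
      k (y 0 - y 1) ≤ k 0 := by
    filter_upwards [h] with y hy
    have hsymm : k (y 1 - y 0) = k (y 0 - y 1) := by rw [← heven, neg_sub]
    simp only [kernelForm, Fin.sum_univ_two, Matrix.cons_val_zero, Matrix.cons_val_one, sub_self,
      hsymm] at hy
    linarith
  have hmp := measurePreserving_finTwoArrow (volume : Measure V)
  have hmeas : MeasurableSet {p : V × V | k (p.1 - p.2) ≤ k 0} :=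
    measurableSet_le (hk.comp (measurable_fst.sub measurable_snd)) measurable_const
  have h2 : ∀ᵐ p ∂(volume : Measure V).prod volume, k (p.1 - p.2) ≤ k 0 := by
    rw [← hmp.map_eq, ae_map_iff hmp.measurable.aemeasurable hmeas]
    exact h1
  have h3 : ∀ᵐ b ∂(volume : Measure V), ∀ᵐ a ∂(volume : Measure V), k (a - b) ≤ k 0 :=
    (Measure.ae_ae_comm hmeas).1 (Measure.ae_ae_of_ae_prod h2)
  obtain ⟨b, hb⟩ := h3.exists
  have hsub := (measurePreserving_sub_right (volume : Measure V) b).map_eq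
  rw [← hsub, ae_map_iff (f := fun x => x - b)
    (measurable_id.sub_const b).aemeasurable (measurableSet_le hk measurable_const)]
  exact hb

end PositiveDefinite

/-! ### Gaussian averages -/

section Gaussian

variable {V : Type*} [NormedAddCommGroup V] [InnerProductSpace ℝ V] [FiniteDimensional ℝ V]
  [MeasurableSpace V] [BorelSpace V]

lemma integrable_exp_neg_mul_norm_sq {b : ℝ} (hb : 0 < b) :
    Integrable fun x : V => Real.exp (-b * ‖x‖ ^ 2) := by
  have h := (GaussianFourier.integrable_cexp_neg_mul_sq_norm_add (V := V) (b := (b : ℂ))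
    (by simpa using hb) 0 0).re
  refine h.congr (ae_of_all _ fun x => ?_)
  simp only [zero_mul, add_zero]
  rw [show (-(b : ℂ) * (‖x‖ : ℂ) ^ 2) = ((-b * ‖x‖ ^ 2 : ℝ) : ℂ) by push_cast; ring]
  rw [← Complex.ofReal_exp]
  exact Complex.ofReal_re _

lemma integral_exp_neg_mul_norm_sq_pos {b : ℝ} (hb : 0 < b) :
    0 < ∫ x : V, Real.exp (-b * ‖x‖ ^ 2) := by
  rw [GaussianFourier.integral_rexp_neg_mul_sq_norm hb]
  have := Real.pi_pos
  positivity

/-- The parallelogram law `‖x‖² + ‖x - z‖² = ‖z‖² / 2 + 2 ‖x - z / 2‖²` shows that the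
autocorrelation of a Gaussian is a Gaussian. -/
lemma integral_gaussian_mul_gaussian_sub (b : ℝ) (z : V) :
    ∫ x : V, Real.exp (-b * ‖x‖ ^ 2) * Real.exp (-b * ‖x - z‖ ^ 2) =
      (∫ x : V, Real.exp (-(2 * b) * ‖x‖ ^ 2)) * Real.exp (-(b / 2) * ‖z‖ ^ 2) := by
  rw [← integral_sub_right_eq_self (fun x : V => Real.exp (-(2 * b) * ‖x‖ ^ 2))
    ((1 / 2 : ℝ) • z), ← integral_mul_const]
  refine integral_congr_ae (ae_of_all _ fun x => ?_)
  simp only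
  rw [← Real.exp_add, ← Real.exp_add]
  congr 1
  rw [norm_sub_sq_real, norm_sub_sq_real, inner_smul_right, norm_smul]
  norm_num
  ring

/-- For two independent points with a common Gaussian law, the mean of a function of their
difference is, up to a positive factor, its integral against a Gaussian. -/
lemma exists_gaussian_law {b : ℝ} (hb : 0 < b) :
    ∃ ν : Measure V, IsProbabilityMeasure ν ∧ ν ≪ volume ∧ ∃ a : ℝ, 0 < a ∧
      ∀ κ : V → ℝ, Integrable κ →
        Integrable (fun q : V × V => κ (q.1 - q.2)) (ν.prod ν) ∧
        ∫ q : V × V, κ (q.1 - q.2) ∂ν.prod ν =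
          a * ∫ z, Real.exp (-(b / 2) * ‖z‖ ^ 2) * κ z := by
  set Γ := ∫ x : V, Real.exp (-b * ‖x‖ ^ 2) with hΓ
  have hΓpos : 0 < Γ := integral_exp_neg_mul_norm_sq_pos hb
  set p : V → ℝ := fun x => Γ⁻¹ * Real.exp (-b * ‖x‖ ^ 2) with hp
  have hpcont : Continuous p := by rw [hp]; fun_prop
  have hp0 : ∀ x, 0 ≤ p x := fun x => mul_nonneg (inv_nonneg.2 hΓpos.le) (Real.exp_nonneg _)
  have hpint : Integrable p := (integrable_exp_neg_mul_norm_sq hb).const_mul _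
  have hple : ∀ x, p x ≤ Γ⁻¹ := by
    intro x
    refine mul_le_of_le_one_right (inv_nonneg.2 hΓpos.le) (Real.exp_le_one_iff.2 ?_)
    nlinarith [sq_nonneg ‖x‖]
  set ν : Measure V := volume.withDensity fun x => ENNReal.ofReal (p x) with hν
  have hpm : Measurable fun x => ENNReal.ofReal (p x) := hpcont.measurable.ennreal_ofReal
  have hprob : IsProbabilityMeasure ν := by
    refine ⟨?_⟩
    rw [hν, withDensity_apply _ MeasurableSet.univ, Measure.restrict_univ,
      ← ofReal_integral_eq_lintegral_ofReal hpint (ae_of_all _ hp0), hp, integral_const_mul,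
      inv_mul_cancel₀ hΓpos.ne', ENNReal.ofReal_one]
  have hle : ν ≤ ENNReal.ofReal Γ⁻¹ • volume := by
    rw [← withDensity_const]
    exact withDensity_mono (ae_of_all _ fun x => ENNReal.ofReal_le_ofReal (hple x))
  have hνint : ∀ F : V → ℝ, ∫ x, F x ∂ν = ∫ x, p x * F x := by
    intro F
    rw [hν, integral_withDensity_eq_integral_toReal_smul hpm
      (ae_of_all _ fun x => ENNReal.ofReal_lt_top)]
    exact integral_congr_ae (ae_of_all _ fun x => by simp [ENNReal.toReal_ofReal (hp0 x)])
  have hΓ2 : 0 < ∫ x : V, Real.exp (-(2 * b) * ‖x‖ ^ 2) :=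
    integral_exp_neg_mul_norm_sq_pos (by positivity)
  refine ⟨ν, hprob, withDensity_absolutelyContinuous _ _,
    Γ⁻¹ * Γ⁻¹ * ∫ x : V, Real.exp (-(2 * b) * ‖x‖ ^ 2), by positivity, fun κ hκ => ?_⟩
  have hint : Integrable (fun q : V × V => κ (q.1 - q.2)) (ν.prod ν) := by
    have h1 : Integrable (fun q : V × V => κ (q.1 - q.2)) ((volume : Measure V).prod ν) := by
      simpa using (integrable_const (μ := ν) (1 : ℝ)).convolution_integrand
        (ContinuousLinearMap.mul ℝ ℝ) hκ
    refine (h1.smul_measure (c := ENNReal.ofReal Γ⁻¹) ENNReal.ofReal_ne_top).mono_measure ?_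
    rw [← Measure.prod_smul_left]
    exact Measure.prod_mono hle le_rfl
  refine ⟨hint, ?_⟩
  have hswap : Integrable (Function.uncurry fun x z : V => p x * (p (x - z) * κ z))
      ((volume : Measure V).prod volume) := by
    have h1 : Integrable (fun q : V × V => p q.1 * κ q.2) ((volume : Measure V).prod volume) :=
      hpint.mul_prod hκ
    have h2 := h1.bdd_mul (c := Γ⁻¹) (f := fun q : V × V => p (q.1 - q.2))
      (by fun_prop) (ae_of_all _ fun q => by
        rw [Real.norm_of_nonneg (hp0 _)]; exact hple _)
    refine h2.congr (ae_of_all _ fun q => ?_)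
    simp only [Function.uncurry]; ring
  calc ∫ q : V × V, κ (q.1 - q.2) ∂ν.prod ν
      = ∫ x, ∫ y, κ (x - y) ∂ν ∂ν := integral_prod _ hint
    _ = ∫ x, ∫ z, p x * (p (x - z) * κ z) := by
        rw [hνint]
        refine integral_congr_ae (ae_of_all _ fun x => ?_)
        simp only
        rw [hνint, integral_const_mul, ← integral_sub_left_eq_self _ volume x]
        simp only [sub_sub_cancel]
    _ = ∫ z, ∫ x, p x * (p (x - z) * κ z) := integral_integral_swap hswap
    _ = _ := by
        rw [← integral_const_mul]
        refine integral_congr_ae (ae_of_all _ fun z => ?_)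
        simp only
        have : ∀ x, p x * (p (x - z) * κ z) = Γ⁻¹ * Γ⁻¹ * κ z *
            (Real.exp (-b * ‖x‖ ^ 2) * Real.exp (-b * ‖x - z‖ ^ 2)) := by
          intro x; simp only [hp]; ring
        simp only [this]
        rw [integral_const_mul, integral_gaussian_mul_gaussian_sub]
        ring

/-- The Gaussian-damped cosine transforms of an almost surely positive definite function are
nonnegative. -/
lemma integral_gaussian_mul_cos_mul_nonneg {k : V → ℝ} (hint : Integrable k)
    (h : ∀ (m : ℕ) (c : Fin m → V → ℝ), (∀ i, Measurable (c i)) →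
      ∀ᵐ y ∂Measure.pi fun _ : Fin m => (volume : Measure V), 0 ≤ kernelForm k c y)
    {b : ℝ} (hb : 0 < b) (ξ : V) :
    0 ≤ ∫ z, Real.exp (-b * ‖z‖ ^ 2) * (Real.cos (2 * Real.pi * inner ℝ z ξ) * k z) := by
  obtain ⟨ν, hprob, hν, a, ha, hκ⟩ := exists_gaussian_law (V := V) (b := 2 * b) (by positivity)
  have hpos : ∀ g : V → ℝ, Continuous g → (∀ x, ‖g x‖ ≤ 1) →
      0 ≤ ∫ q : V × V, g q.1 * g q.2 * k (q.1 - q.2) ∂ν.prod ν := fun g hg hg1 =>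
    integral_prod_nonneg_of_kernelForm_nonneg (hκ k hint).1 hg.measurable hg1 fun m =>
      absolutelyContinuous_pi hν m (h m _ fun _ => hg.measurable)
  have hprodint : ∀ g : V → ℝ, Continuous g → (∀ x, ‖g x‖ ≤ 1) →
      Integrable (fun q : V × V => g q.1 * g q.2 * k (q.1 - q.2)) (ν.prod ν) := by
    intro g hg hg1
    refine (hκ k hint).1.bdd_mul (c := 1) (by fun_prop) (ae_of_all _ fun q => ?_)
    rw [norm_mul]
    exact mul_le_one₀ (hg1 _) (norm_nonneg _) (hg1 _)
  have hcoscont : Continuous fun x : V => Real.cos (2 * Real.pi * inner ℝ x ξ) := by fun_prop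
  have hsincont : Continuous fun x : V => Real.sin (2 * Real.pi * inner ℝ x ξ) := by fun_prop
  have hcos1 : ∀ x : V, ‖Real.cos (2 * Real.pi * inner ℝ x ξ)‖ ≤ 1 := fun x =>
    Real.abs_cos_le_one _
  have hsin1 : ∀ x : V, ‖Real.sin (2 * Real.pi * inner ℝ x ξ)‖ ≤ 1 := fun x =>
    Real.abs_sin_le_one _
  have hκint : Integrable fun z => Real.cos (2 * Real.pi * inner ℝ z ξ) * k z :=
    hint.bdd_mul (c := 1) hcoscont.aestronglyMeasurable (ae_of_all _ hcos1)
  have hsum := add_nonneg (hpos _ hcoscont hcos1) (hpos _ hsincont hsin1)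
  rw [← integral_add (hprodint _ hcoscont hcos1) (hprodint _ hsincont hsin1)] at hsum
  -- The addition formula turns the sum of the two forms into a function of the difference.
  have heq : ∀ q : V × V,
      Real.cos (2 * Real.pi * inner ℝ q.1 ξ) * Real.cos (2 * Real.pi * inner ℝ q.2 ξ) *
          k (q.1 - q.2) +
        Real.sin (2 * Real.pi * inner ℝ q.1 ξ) * Real.sin (2 * Real.pi * inner ℝ q.2 ξ) *
          k (q.1 - q.2) =
      Real.cos (2 * Real.pi * inner ℝ (q.1 - q.2) ξ) * k (q.1 - q.2) := by
    intro q
    rw [inner_sub_left, mul_sub, Real.cos_sub]; ring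
  simp only [heq] at hsum
  rw [(hκ _ hκint).2] at hsum
  have := nonneg_of_mul_nonneg_right hsum ha
  simpa using this

end Gaussian

/-! ### Almost surely positive definite integrable functions are Fourier–Stieltjes transforms -/

section Bochner

open scoped FourierTransform

lemma tendsto_exp_neg_inv_mul {V : Type*} [NormedAddCommGroup V] (z : V) (r : ℝ) :
    Tendsto (fun n : ℕ => Real.exp (-((n : ℝ) + 1)⁻¹ * ‖z‖ ^ 2) * r) atTop (𝓝 r) := by
  have h1 : Tendsto (fun n : ℕ => -((n : ℝ) + 1)⁻¹ * ‖z‖ ^ 2) atTop (𝓝 (-0 * ‖z‖ ^ 2)) := by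
    refine (Tendsto.neg ?_).mul_const _
    simpa using tendsto_one_div_add_atTop_nhds_zero_nat (𝕜 := ℝ)
  have h2 := ((Real.continuous_exp.tendsto _).comp h1).mul_const r
  simpa using h2

variable {V : Type*} [NormedAddCommGroup V] [InnerProductSpace ℝ V] [FiniteDimensional ℝ V]
  [MeasurableSpace V] [BorelSpace V]

lemma continuous_fourier_of_integrable {f : V → ℂ} (hf : Integrable f) : Continuous (𝓕 f) := by
  simpa using! VectorFourier.fourierIntegral_continuous Real.continuous_fourierChar
    (L := innerₗ V) continuous_inner hf

lemma integral_fourier_mul_eq_integral_mul_fourier {f g : V → ℂ} (hf : Integrable f)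
    (hg : Integrable g) : ∫ x, 𝓕 f x * g x = ∫ x, f x * 𝓕 g x := by
  simpa using! VectorFourier.integral_fourierIntegral_smul_eq_flip (L := innerₗ V)
    Real.continuous_fourierChar continuous_inner hf hg

/-- The Fourier transform of a real even function is its cosine transform. -/
lemma fourier_ofReal_eq_cos {k : V → ℝ} (hint : Integrable k) (heven : ∀ x, k (-x) = k x) (ξ : V) :
    𝓕 (fun x => (k x : ℂ)) ξ = ((∫ z, Real.cos (2 * Real.pi * inner ℝ z ξ) * k z : ℝ) : ℂ) := by
  have hcos : Integrable fun z => Real.cos (2 * Real.pi * inner ℝ z ξ) * k z :=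
    hint.bdd_mul (c := 1) (by fun_prop : Continuous fun z : V =>
      Real.cos (2 * Real.pi * inner ℝ z ξ)).aestronglyMeasurable
      (ae_of_all _ fun z => Real.abs_cos_le_one _)
  have hsin : Integrable fun z => Real.sin (2 * Real.pi * inner ℝ z ξ) * k z :=
    hint.bdd_mul (c := 1) (by fun_prop : Continuous fun z : V =>
      Real.sin (2 * Real.pi * inner ℝ z ξ)).aestronglyMeasurable
      (ae_of_all _ fun z => Real.abs_sin_le_one _)
  have hodd : ∫ z, Real.sin (2 * Real.pi * inner ℝ z ξ) * k z = 0 := by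
    have h := integral_neg_eq_self
      (fun z : V => Real.sin (2 * Real.pi * inner ℝ z ξ) * k z) volume
    simp only [heven, inner_neg_left, mul_neg, Real.sin_neg, neg_mul, integral_neg] at h
    linarith
  rw [Real.fourier_eq']
  have hpt : ∀ z : V, Complex.exp (((-2 * Real.pi * inner ℝ z ξ : ℝ) : ℂ) * Complex.I) • (k z : ℂ) =
      ((Real.cos (2 * Real.pi * inner ℝ z ξ) * k z : ℝ) : ℂ) -
        ((Real.sin (2 * Real.pi * inner ℝ z ξ) * k z : ℝ) : ℂ) * Complex.I := by
    intro z
    rw [show -2 * Real.pi * inner ℝ z ξ = -(2 * Real.pi * inner ℝ z ξ) by ring, Complex.exp_mul_I,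
      ← Complex.ofReal_cos, ← Complex.ofReal_sin, Real.cos_neg, Real.sin_neg, smul_eq_mul]
    push_cast; ring
  simp only [hpt]
  rw [integral_sub hcos.ofReal (hsin.ofReal.mul_const _), integral_mul_const,
    integral_complex_ofReal, integral_complex_ofReal, hodd]
  simp

lemma tendsto_integral_gaussian_mul {f : V → ℝ} (hf : Integrable f) :
    Tendsto (fun n : ℕ => ∫ z, Real.exp (-((n : ℝ) + 1)⁻¹ * ‖z‖ ^ 2) * f z) atTop
      (𝓝 (∫ z, f z)) := by
  refine tendsto_integral_of_dominated_convergence (fun z => ‖f z‖) (fun n => ?_) hf.norm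
    (fun n => ae_of_all _ fun z => ?_) (ae_of_all _ fun z => ?_)
  · exact (by fun_prop : Continuous fun z : V =>
      Real.exp (-((n : ℝ) + 1)⁻¹ * ‖z‖ ^ 2)).aestronglyMeasurable.mul hf.aestronglyMeasurable
  · rw [norm_mul, Real.norm_of_nonneg (Real.exp_nonneg _)]
    refine mul_le_of_le_one_left (norm_nonneg _) (Real.exp_le_one_iff.2 ?_)
    rw [neg_mul]
    exact neg_nonpos.2 (by positivity)
  · exact tendsto_exp_neg_inv_mul z (f z)

/-- A Gaussian is the Fourier transform of a positive integrable function of total mass one. -/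
lemma exists_fourier_gaussian_eq {b : ℝ} (hb : 0 < b) :
    ∃ G : V → ℝ, (∀ x, 0 ≤ G x) ∧ (∃ M, ∀ x, ‖G x‖ ≤ M) ∧ Integrable G ∧ ∫ x, G x = 1 ∧
      ∀ x, 𝓕 (fun v : V => ((Real.exp (-b * ‖v‖ ^ 2) : ℝ) : ℂ)) x = G x := by
  have hexp : ∀ v : V, ((Real.exp (-b * ‖v‖ ^ 2) : ℝ) : ℂ) = Complex.exp (-b * ‖v‖ ^ 2) := by
    intro v; push_cast; rfl
  set G : V → ℝ := fun x => (Real.pi / b) ^ (Module.finrank ℝ V / 2 : ℝ) *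
    Real.exp (-(Real.pi ^ 2 / b) * ‖x‖ ^ 2) with hG
  have hpib : 0 < Real.pi ^ 2 / b := by have := Real.pi_pos; positivity
  have hGint : Integrable G := (integrable_exp_neg_mul_norm_sq hpib).const_mul _
  have hF : ∀ x, 𝓕 (fun v : V => ((Real.exp (-b * ‖v‖ ^ 2) : ℝ) : ℂ)) x = G x := by
    intro x
    simp only [hexp]
    rw [fourier_gaussian_innerProductSpace (by simpa using hb), hG]
    have hpos : 0 ≤ Real.pi / b := by have := Real.pi_pos; positivity
    push_cast
    rw [Complex.ofReal_cpow hpos]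
    push_cast
    congr 2
    ring
  have hG0 : ∀ x, 0 ≤ G x := fun x => by have := Real.pi_pos; simp only [hG]; positivity
  have hGle : ∀ x, ‖G x‖ ≤ (Real.pi / b) ^ (Module.finrank ℝ V / 2 : ℝ) := by
    intro x
    rw [Real.norm_of_nonneg (hG0 x)]
    have := Real.pi_pos
    refine mul_le_of_le_one_right (by positivity) (Real.exp_le_one_iff.2 ?_)
    rw [neg_mul]
    exact neg_nonpos.2 (by positivity)
  refine ⟨G, hG0, ⟨_, hGle⟩, hGint, ?_, hF⟩
  have hgcont : Continuous fun v : V => ((Real.exp (-b * ‖v‖ ^ 2) : ℝ) : ℂ) := by fun_prop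
  have hFeq : 𝓕 (fun v : V => ((Real.exp (-b * ‖v‖ ^ 2) : ℝ) : ℂ)) = fun x => (G x : ℂ) :=
    funext hF
  have hinv := congrFun (hgcont.fourierInv_fourier_eq
    (integrable_exp_neg_mul_norm_sq hb).ofReal (hFeq ▸ hGint.ofReal)) 0
  rw [hFeq, Real.fourierInv_eq'] at hinv
  simp only [inner_zero_right, mul_zero, Complex.ofReal_zero, zero_mul, Complex.exp_zero, one_smul,
    norm_zero, ne_eq, OfNat.ofNat_ne_zero, not_false_eq_true, zero_pow, Real.exp_zero,
    Complex.ofReal_one] at hinv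
  rw [integral_complex_ofReal] at hinv
  exact_mod_cast hinv

/-- Bochner's theorem for an integrable even function `k` whose forms are almost everywhere
nonnegative: `𝓕 k` is nonnegative, its integral is at most `k 0` because that is so for all its
Gaussian dampings, and `k` is recovered from `𝓕 k` almost everywhere by testing against smooth
functions. -/
lemma exists_measure_of_ae_kernelForm_nonneg {k : V → ℝ} (hk : Measurable k) (hint : Integrable k)
    (heven : ∀ x, k (-x) = k x)
    (h : ∀ (m : ℕ) (c : Fin m → V → ℝ), (∀ i, Measurable (c i)) →
      ∀ᵐ y ∂Measure.pi fun _ : Fin m => (volume : Measure V), 0 ≤ kernelForm k c y) :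
    ∃ μ : Measure V, IsFiniteMeasure μ ∧ ∀ᵐ x,
      (k x : ℂ) = ∫ t, Complex.exp (-(2 * Real.pi * Complex.I * (inner ℝ t x : ℝ))) ∂μ := by
  set φ : V → ℝ := fun ξ => ∫ z, Real.cos (2 * Real.pi * inner ℝ z ξ) * k z with hφ
  have hφF : 𝓕 (fun x => (k x : ℂ)) = fun ξ => (φ ξ : ℂ) :=
    funext (fourier_ofReal_eq_cos hint heven)
  have hkc : Integrable fun x => (k x : ℂ) := hint.ofReal
  have hφcont : Continuous φ := by
    have h1 := continuous_fourier_of_integrable hkc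
    have h2 : φ = fun ξ => (𝓕 (fun x => (k x : ℂ)) ξ).re := by rw [hφF]; simp
    rw [h2]
    exact Complex.continuous_re.comp h1
  have hφ0 : ∀ ξ, 0 ≤ φ ξ := by
    intro ξ
    have hκint : Integrable fun z => Real.cos (2 * Real.pi * inner ℝ z ξ) * k z :=
      hint.bdd_mul (c := 1) (by fun_prop : Continuous fun z : V =>
        Real.cos (2 * Real.pi * inner ℝ z ξ)).aestronglyMeasurable
        (ae_of_all _ fun z => Real.abs_cos_le_one _)
    exact ge_of_tendsto' (tendsto_integral_gaussian_mul hκint) fun n =>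
      integral_gaussian_mul_cos_mul_nonneg hint h (by positivity) ξ
  have hk0 : ∀ᵐ z, k z ≤ k 0 := ae_le_apply_zero hk heven (h 2 _ fun i => measurable_const)
  have hdamped : ∀ b : ℝ, 0 < b →
      ∫⁻ ξ, ENNReal.ofReal (Real.exp (-b * ‖ξ‖ ^ 2) * φ ξ) ≤ ENNReal.ofReal (k 0) := by
    intro b hb
    obtain ⟨G, hG0, ⟨M, hGM⟩, hGint, hG1, hGF⟩ := exists_fourier_gaussian_eq (V := V) hb
    have hexpint := integrable_exp_neg_mul_norm_sq (V := V) hb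
    have hφbdd : ∀ ξ, ‖φ ξ‖ ≤ ∫ z, ‖k z‖ := by
      intro ξ
      refine (norm_integral_le_integral_norm _).trans
        (integral_mono_of_nonneg (ae_of_all _ fun z => norm_nonneg _) hint.norm
          (ae_of_all _ fun z => ?_))
      simp only [norm_mul]
      exact mul_le_of_le_one_left (norm_nonneg _) (Real.abs_cos_le_one _)
    have hprod : Integrable fun ξ => Real.exp (-b * ‖ξ‖ ^ 2) * φ ξ := by
      refine (hexpint.bdd_mul hφcont.aestronglyMeasurable (ae_of_all _ hφbdd)).congr
        (ae_of_all _ fun ξ => mul_comm _ _)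
    have hexpc : Integrable fun x : V => ((Real.exp (-b * ‖x‖ ^ 2) : ℝ) : ℂ) := hexpint.ofReal
    have hflip := integral_fourier_mul_eq_integral_mul_fourier hexpc hkc
    rw [hφF] at hflip
    have hreal : ∫ ξ, Real.exp (-b * ‖ξ‖ ^ 2) * φ ξ = ∫ x, G x * k x := by
      have h1 : ∀ x, 𝓕 (fun v : V => ((Real.exp (-b * ‖v‖ ^ 2) : ℝ) : ℂ)) x * (k x : ℂ) =
          ((G x * k x : ℝ) : ℂ) := by
        intro x; rw [hGF]; push_cast; rfl
      have h2 : ∀ x, ((Real.exp (-b * ‖x‖ ^ 2) : ℝ) : ℂ) * (φ x : ℂ) =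
          ((Real.exp (-b * ‖x‖ ^ 2) * φ x : ℝ) : ℂ) := by
        intro x; push_cast; rfl
      have h3 : ∫ x, ((G x * k x : ℝ) : ℂ) =
          ∫ x, ((Real.exp (-b * ‖x‖ ^ 2) * φ x : ℝ) : ℂ) := by
        rw [← integral_congr_ae (ae_of_all _ h1), ← integral_congr_ae (ae_of_all _ h2)]
        exact hflip
      rw [integral_complex_ofReal, integral_complex_ofReal] at h3
      exact (Complex.ofReal_inj.1 h3).symm
    rw [← ofReal_integral_eq_lintegral_ofReal hprod
      (ae_of_all _ fun ξ => mul_nonneg (Real.exp_nonneg _) (hφ0 ξ)), hreal]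
    refine ENNReal.ofReal_le_ofReal ?_
    have hGk : Integrable fun x => G x * k x :=
      hint.bdd_mul hGint.aestronglyMeasurable (ae_of_all _ hGM)
    calc ∫ x, G x * k x ≤ ∫ x, G x * k 0 := by
          refine integral_mono_ae hGk (hGint.mul_const _) ?_
          filter_upwards [hk0] with x hx
          exact mul_le_mul_of_nonneg_left hx (hG0 x)
      _ = k 0 := by rw [integral_mul_const, hG1, one_mul]
  have hφlint : ∫⁻ ξ, ENNReal.ofReal (φ ξ) ≤ ENNReal.ofReal (k 0) := by
    have hlim : ∀ ξ, Tendsto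
        (fun n : ℕ => ENNReal.ofReal (Real.exp (-((n : ℝ) + 1)⁻¹ * ‖ξ‖ ^ 2) * φ ξ)) atTop
        (𝓝 (ENNReal.ofReal (φ ξ))) :=
      fun ξ => ENNReal.tendsto_ofReal (tendsto_exp_neg_inv_mul ξ (φ ξ))
    calc ∫⁻ ξ, ENNReal.ofReal (φ ξ)
        = ∫⁻ ξ, liminf (fun n : ℕ =>
            ENNReal.ofReal (Real.exp (-((n : ℝ) + 1)⁻¹ * ‖ξ‖ ^ 2) * φ ξ)) atTop :=
          lintegral_congr fun ξ => (hlim ξ).liminf_eq.symm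
      _ ≤ liminf (fun n : ℕ => ∫⁻ ξ,
            ENNReal.ofReal (Real.exp (-((n : ℝ) + 1)⁻¹ * ‖ξ‖ ^ 2) * φ ξ)) atTop :=
          lintegral_liminf_le fun n => by fun_prop
      _ ≤ ENNReal.ofReal (k 0) := by
          refine liminf_le_of_le (by isBoundedDefault) fun a ha => ?_
          obtain ⟨n, hn⟩ := ha.exists
          exact hn.trans (hdamped _ (by positivity))
  have hφint : Integrable φ := by
    refine ⟨hφcont.aestronglyMeasurable, ?_⟩
    rw [hasFiniteIntegral_iff_ofReal (ae_of_all _ hφ0)]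
    exact hφlint.trans_lt ENNReal.ofReal_lt_top
  -- Weak Fourier inversion: `k` is only integrable, so its inversion formula is tested against
  -- smooth functions, where it reduces to inversion for Schwartz functions.
  have hFφ : ∀ᵐ x, (k x : ℂ) = 𝓕 (fun ξ => (φ ξ : ℂ)) x := by
    have hφc : Integrable fun ξ => (φ ξ : ℂ) := hφint.ofReal
    refine ae_eq_of_integral_contDiff_smul_eq hkc.locallyIntegrable
      (continuous_fourier_of_integrable hφc).locallyIntegrable fun g hg hgc => ?_
    set s : SchwartzMap V ℂ := HasCompactSupport.toSchwartzMap (f := fun x => (g x : ℂ))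
      (hgc.comp_left (g := Complex.ofReal) rfl)
      (Complex.ofRealCLM.contDiff.comp hg)
    have hFF : ∀ x, 𝓕 (𝓕 (s : V → ℂ)) x = s (-x) := by
      intro x
      have h1 := Real.fourierInv_eq_fourier_neg (𝓕 (s : V → ℂ)) (-x)
      rw [neg_neg] at h1
      rw [← h1, s.continuous.fourierInv_fourier_eq s.integrable (𝓕 s).integrable]
    have h1 : ∫ x, (s : V → ℂ) x * 𝓕 (fun ξ => (φ ξ : ℂ)) x = ∫ x, s (-x) * (k x : ℂ) := by
      have h3 := integral_fourier_mul_eq_integral_mul_fourier (𝓕 s).integrable hkc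
      rw [hφF] at h3
      rw [← integral_fourier_mul_eq_integral_mul_fourier s.integrable hφc]
      refine h3.symm.trans ?_
      exact integral_congr_ae (ae_of_all _ fun x => congrArg (· * (k x : ℂ)) (hFF x))
    have h2 : ∫ x, s (-x) * (k x : ℂ) = ∫ x, s x * (k x : ℂ) := by
      rw [← integral_neg_eq_self (fun x => s x * (k x : ℂ)) volume]
      simp only [heven]
    simp only [Complex.real_smul]
    exact (h1.trans h2).symm
  refine ⟨volume.withDensity fun ξ => ENNReal.ofReal (φ ξ),
    isFiniteMeasure_withDensity_ofReal hφint.2, ?_⟩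
  filter_upwards [hFφ] with x hx
  rw [hx, Real.fourier_eq', integral_withDensity_eq_integral_toReal_smul
    hφcont.measurable.ennreal_ofReal (ae_of_all _ fun ξ => ENNReal.ofReal_lt_top)]
  refine integral_congr_ae (ae_of_all _ fun t => ?_)
  simp only [ENNReal.toReal_ofReal (hφ0 t), Complex.real_smul, smul_eq_mul]
  rw [mul_comm]
  congr 2
  push_cast; ring

end Bochner

/-! ### The smoothing matrix -/

/-- Coordinatewise multiplication by the bandwidths. -/
noncomputable def bandwidthEquiv {d : ℕ} (h : Fin d → ℝ) (hh : ∀ j, h j ≠ 0) :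
    EuclideanSpace ℝ (Fin d) ≃L[ℝ] EuclideanSpace ℝ (Fin d) :=
  LinearEquiv.toContinuousLinearEquiv
    { toFun := fun y => WithLp.toLp 2 fun j => h j * y j
      invFun := fun x => WithLp.toLp 2 fun j => x j / h j
      map_add' := fun x y => by ext j; simp [mul_add]
      map_smul' := fun r x => by ext j; simp [mul_left_comm]
      left_inv := fun x => by ext j; simp [hh j]
      right_inv := fun x => by ext j; simp [mul_div_cancel₀ _ (hh j)] }

section SmoothingMatrix

variable {d : ℕ} (N : Seminorm ℝ (EuclideanSpace ℝ (Fin d))) (K : ℝ → ℝ)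

lemma weightedDist_eq (h : Fin d → ℝ) (hh : ∀ j, h j ≠ 0) (x y : EuclideanSpace ℝ (Fin d)) :
    weightedDist N h x y = N ((bandwidthEquiv h hh).symm (x - y)) := rfl

lemma norm_bandwidthEquiv_le {h : Fin d → ℝ} {h₀ : ℝ} (hh : ∀ j, 0 < h j ∧ h j ≤ h₀) (hh₀ : 0 ≤ h₀)
    (y : EuclideanSpace ℝ (Fin d)) :
    ‖bandwidthEquiv h (fun j => (hh j).1.ne') y‖ ≤ h₀ * ‖y‖ := by
  have hsq : h₀ * ‖y‖ = √(h₀ ^ 2 * ∑ j, ‖y j‖ ^ 2) := by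
    rw [Real.sqrt_mul (sq_nonneg _), Real.sqrt_sq hh₀, EuclideanSpace.norm_eq]
  rw [hsq, EuclideanSpace.norm_eq, Finset.mul_sum]
  refine Real.sqrt_le_sqrt (Finset.sum_le_sum fun j _ => ?_)
  have : bandwidthEquiv h (fun j => (hh j).1.ne') y j = h j * y j := rfl
  rw [this, norm_mul, mul_pow, Real.norm_of_nonneg (hh j).1.le]
  have h1 := (hh j).1
  have h2 := (hh j).2
  gcongr

/-- The kernel matrix `(K (d_h(x_i, x_j)))` whose row normalization is the smoothing matrix. -/
noncomputable def kernelMatrix {n : ℕ} (h : Fin d → ℝ) (x : Fin n → EuclideanSpace ℝ (Fin d)) :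
    Matrix (Fin n) (Fin n) ℝ :=
  Matrix.of fun i j => K (weightedDist N h (x i) (x j))

lemma nadarayaWatson_eq_rowNormalize {n : ℕ} (h : Fin d → ℝ)
    (x : Fin n → EuclideanSpace ℝ (Fin d)) :
    nadarayaWatson N h K x = rowNormalize (kernelMatrix N K h x) := rfl

lemma kernelMatrix_symm {n : ℕ} (h : Fin d → ℝ) (x : Fin n → EuclideanSpace ℝ (Fin d))
    (i j : Fin n) : kernelMatrix N K h x i j = kernelMatrix N K h x j i := by
  have : (WithLp.toLp 2 fun l => (x i l - x j l) / h l : EuclideanSpace ℝ (Fin d)) =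
      -WithLp.toLp 2 fun l => (x j l - x i l) / h l := by
    ext l; simp [← neg_div]
  simp only [kernelMatrix, Matrix.of_apply, weightedDist]
  rw [this, map_neg_eq_map]

/-- A negative value of the quadratic form on a subfamily of the design points extends to the whole
kernel matrix. -/
lemma spectrumMaxGtOne_of_subfamily_neg (hK : ∀ r, 0 ≤ K r) {n m : ℕ} (h : Fin d → ℝ)
    (x : Fin n → EuclideanSpace ℝ (Fin d)) (e : Fin m → Fin n) (c : Fin m → ℝ)
    (hc : ∑ i, ∑ j, c i * c j * K (weightedDist N h (x (e i)) (x (e j))) < 0) :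
    SpectrumMaxGtOne (1 - nadarayaWatson N h K x) := by
  rw [nadarayaWatson_eq_rowNormalize]
  obtain ⟨a, ha⟩ : ∃ a : Fin n → ℝ, ∑ i, ∑ j, a i * a j * kernelMatrix N K h x i j < 0 := by
    by_contra! hall
    have hpsd : (kernelMatrix N K h x).PosSemidef := by
      refine Matrix.PosSemidef.of_dotProduct_mulVec_nonneg ?_ fun a => ?_
      · ext i j
        exact kernelMatrix_symm N K h x j i
      · refine (hall a).trans (le_of_eq ?_)
        simp only [dotProduct, Matrix.mulVec, Pi.star_apply, star_trivial, Finset.mul_sum]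
        exact Finset.sum_congr rfl fun i _ => Finset.sum_congr rfl fun j _ => by ring
    refine absurd hc (not_lt.2 (((hpsd.submatrix e).dotProduct_mulVec_nonneg c).trans
      (le_of_eq ?_)))
    simp only [dotProduct, Matrix.mulVec, Pi.star_apply, star_trivial, Finset.mul_sum,
      Matrix.submatrix_apply, kernelMatrix, Matrix.of_apply]
    exact Finset.sum_congr rfl fun i _ => Finset.sum_congr rfl fun j _ => by ring
  exact spectrumMaxGtOne_one_sub_rowNormalize (fun i j => hK _) (kernelMatrix_symm N K h x) ha

lemma measurable_seminorm : Measurable N :=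
  N.convexOn.locallyLipschitz.continuous.measurable

end SmoothingMatrix

lemma restrict_absolutelyContinuous_withDensity {α : Type*} [MeasurableSpace α] {μ : Measure α}
    {f : α → ℝ} (hf : Measurable f) {C : Set α} {c : ℝ} (hc : 0 < c)
    (hfC : ∀ x ∈ C, c ≤ f x) :
    μ.restrict C ≪ μ.withDensity fun x => ENNReal.ofReal (f x) := by
  refine Measure.AbsolutelyContinuous.mk fun s hs h0 => ?_
  rw [withDensity_apply _ hs, lintegral_eq_zero_iff hf.ennreal_ofReal, Filter.EventuallyEq,
    ae_restrict_iff' hs] at h0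
  rw [Measure.restrict_apply hs, measure_eq_zero_iff_ae_notMem]
  filter_upwards [h0] with x hx hxs
  have := hx hxs.1
  simp only [Pi.zero_apply, ENNReal.ofReal_eq_zero] at this
  linarith [hfC x hxs.2]

theorem mainTheorem3 {d : ℕ} (N : Seminorm ℝ (EuclideanSpace ℝ (Fin d)))
    (hN : ∀ x, N x = 0 → x = 0)
    (K : ℝ → ℝ) (hKmeas : Measurable K) (hKnonneg : ∀ r, 0 ≤ K r) :
    -- first part: arbitrary sample size, bandwidths and design points
    (InverseFSIsPositive (fun x : EuclideanSpace ℝ (Fin d) => K (N x)) →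
      ∀ (n : ℕ) (h : Fin d → ℝ), (∀ j, 0 < h j) →
        ∀ x : Fin n → EuclideanSpace ℝ (Fin d),
          complexSpectrum (nadarayaWatson N h K x) ⊆ Complex.ofReal '' Set.Icc 0 1) ∧
    -- converse
    (Integrable (fun x : EuclideanSpace ℝ (Fin d) => K (N x)) →
      ¬ InverseFSIsPositiveAE (fun x : EuclideanSpace ℝ (Fin d) => K (N x)) →
      ∀ C : Set (EuclideanSpace ℝ (Fin d)), IsCompact C → 0 < volume C →
        ∃ h₀ : ℝ, 0 < h₀ ∧ ∀ h : Fin d → ℝ, (∀ j, 0 < h j ∧ h j ≤ h₀) →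
          ∀ f : EuclideanSpace ℝ (Fin d) → ℝ, Measurable f → (∀ x, 0 ≤ f x) →
          (∃ c : ℝ, 0 < c ∧ ∀ x ∈ C, c ≤ f x) →
          ∀ (Ω : Type*) [MeasurableSpace Ω] (P : Measure Ω) [IsProbabilityMeasure P]
            (X : ℕ → Ω → EuclideanSpace ℝ (Fin d)),
            (∀ i, Measurable (X i)) → iIndepFun X P →
            (∀ i, P.map (X i) = volume.withDensity (fun x => ENNReal.ofReal (f x))) →
            Tendsto (fun n : ℕ => P {ω | SpectrumMaxGtOne
                (1 - nadarayaWatson N h K (fun i : Fin n => X i ω))}) atTop (𝓝 1)) := by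
  refine ⟨fun hFS n h hh x z hz => ?_, fun hint hFS C hC hCpos => ?_⟩
  · rw [nadarayaWatson_eq_rowNormalize] at hz
    obtain ⟨s, rfl, hs1, hs0⟩ := exists_real_of_mem_complexSpectrum_rowNormalize
      (fun i j => hKnonneg _) (kernelMatrix_symm N K h x) hz
    refine ⟨s, ⟨hs0 fun c => ?_, hs1⟩, rfl⟩
    refine (fourierStieltjes_sum_nonneg hFS c
      fun i => (bandwidthEquiv h fun j => (hh j).ne').symm (x i)).trans (le_of_eq ?_)
    simp only [← map_sub]
    rfl
  · set k : EuclideanSpace ℝ (Fin d) → ℝ := fun x => K (N x) with hk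
    have hkmeas : Measurable k := hKmeas.comp (measurable_seminorm N)
    obtain ⟨m, c, hc, hneg⟩ : ∃ (m : ℕ) (c : Fin m → EuclideanSpace ℝ (Fin d) → ℝ),
        (∀ i, Measurable (c i)) ∧ ¬ ∀ᵐ y ∂Measure.pi fun _ : Fin m =>
          (volume : Measure (EuclideanSpace ℝ (Fin d))), 0 ≤ kernelForm k c y := by
      by_contra! hall
      exact hFS (exists_measure_of_ae_kernelForm_nonneg hkmeas hint
        (fun x => by simp only [hk, map_neg_eq_map]) hall)
    -- A probability measure with the same null sets as Lebesgue measure.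
    set ν : Measure (EuclideanSpace ℝ (Fin d)) :=
      (volume : Measure (EuclideanSpace ℝ (Fin d))).toFinite
    have hneg' : Measure.pi (fun _ : Fin m => ν) {y | kernelForm k c y < 0} ≠ 0 := by
      intro h0
      apply hneg
      rw [ae_iff]
      simpa only [not_le] using
        absolutelyContinuous_pi (absolutelyContinuous_toFinite volume) m h0
    obtain ⟨h₀, hh₀, htransport⟩ := exists_pos_forall_kernelForm_rescaled_neg hkmeas
      (toFinite_absolutelyContinuous volume) hc hneg' hC hCpos
    refine ⟨h₀, hh₀, fun h hh f hf _ ⟨a, ha, hfC⟩ Ω _ P _ X hX hindep hlaw => ?_⟩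
    have hne : ∀ j, h j ≠ 0 := fun j => (hh j).1.ne'
    set T := bandwidthEquiv h hne with hT
    set ρ : Measure (EuclideanSpace ℝ (Fin d)) :=
      volume.withDensity fun x => ENNReal.ofReal (f x)
    have hρ : IsProbabilityMeasure ρ :=
      hlaw 0 ▸ Measure.isProbabilityMeasure_map (hX 0).aemeasurable
    obtain ⟨x₀, hx₀⟩ := htransport T (norm_bandwidthEquiv_le hh hh₀.le) ρ
      (restrict_absolutelyContinuous_withDensity hf ha hfC)
    have hTm : Measurable T.symm := T.symm.continuous.measurable
    have hG : MeasurableSet {x | kernelForm (fun z => k (T.symm z))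
        (fun (i : Fin m) x => c i (T.symm (x - x₀))) x < 0} :=
      measurable_kernelForm (hkmeas.comp hTm)
        (fun i => (hc i).comp (hTm.comp (measurable_id.sub_const x₀))) measurableSet_Iio
    refine tendsto_of_tendsto_of_tendsto_of_le_of_le
      (tendsto_measure_exists_block hX hindep hlaw hG hx₀) tendsto_const_nhds
      (fun n => measure_mono ?_) fun n => prob_le_one
    rintro ω ⟨j, hj, hω⟩
    have hlt : ∀ i : Fin m, j * m + i < n := fun i =>
      lt_of_lt_of_le (by rw [add_one_mul]; exact Nat.add_lt_add_left i.2 _) hj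
    refine spectrumMaxGtOne_of_subfamily_neg N K hKnonneg h _
      (fun i : Fin m => ⟨j * m + i, hlt i⟩) (fun i => c i (T.symm (X (j * m + i) ω - x₀))) ?_
    simpa only [weightedDist_eq N h hne] using! hω
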